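/- **Canonicity of simple independence relations.** On an AECat with the amalgamation property there is at most one simple independence relation. Here the notions are as follows. *AECat.* An AECat $(\mathcal C,\mathcal M)$ consists of an accessible category $\mathcal C$ and a full subcategory $\mathcal M$ of $\mathcal C$ (whose objects are called models) that is also accessible, such that $\mathcal M$ has directed colimits (over non-empty directed posets), the inclusion $\mathcal M\hookrightarrow\mathcal C$ preserves them, and all arrows of $\mathcal C$ are monomorphisms. It has the amalgamation property if for every span $N_1\xleftarrow{f_1}M\xrightarrow{f_2}N_2$ of models there are arrows $N_1\xrightarrow{g_1}U\xleftarrow{g_2}N_2$ into a model $U$ with $g_1f_1=g_2f_2$. An extension of a model $M$ is an arrow $M\to N$ with $N$ a model; arrows into $M$ and subobjects of $M$ are regarded as arrows into, respectively subobjects of, $N$ by composition with it. *Galois types.* Let $M, M'$ be models. Tuples of arrows $(a_i\colon A_i\to M)_i$ and $(a_i'\colon A_i\to M')_i$ have the same Galois type, written $\mathrm{gtp}((a_i)_i;M)=\mathrm{gtp}((a_i')_i;M')$, if there are extensions $f\colon M\to N$ and $g\colon M'\to N$ with $fa_i=ga_i'$ for all $i$. Tuples of subobjects $(A_i)_i$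 of $M$ and $(A'_i)_i$ of $M'$ have the same Galois type if there are extensions $M\to N\leftarrow M'$ such that $A_i=A_i'$ as subobjects of $N$ for all $i$. *Simple independence relations.* An independence relation is a relation on triples of subobjects of models; we write $A\perp^M_C B$ if the triple $(A,B,C)$ of subobjects of the model $M$ is in the relation. It is simple if it has all of the following properties. - Invariance: if $A\perp^M_C B$ and $\mathrm{gtp}(A,B,C;M)=\mathrm{gtp}(A',B',C';M')$, then $A'\perp^{M'}_{C'}B'$. - Monotonicity: if $A\perp^M_C B$ and $B'\le B$, then $A\perp^M_C B'$. - Base-monotonicity: if $A\perp^M_C B$ and $C\le C'\le B$, then $A\perp^M_{C'}B$. - Transitivity: if $B\le C$, $A\perp^M_B C$ and $A\perp^M_C D$, then there are an extension $M\to N$ and $E\le N$ with $C,D\le E$ and $A\perp^N_B E$. - Symmetry: if $A\perp^M_C B$, then $B\perp^M_C A$. - Existence: for all arrows $a\colon A\to M$ and $c\colon C\to M$ into a model $M$ and every $B\le M$ there are an extension $M\to M'$ and an arrow $a'\colon A\to M'$, representing a subobject $A'$, such that $A'\perp^{M'}_C B$ and $\mathrm{gtp}(a',c;M')=\mathrm{gtp}(a,c;M)$.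 - Union: if $(B_i)_{i\in I}$ is a directed system in $\mathcal C$ over a non-empty directed poset $I$, with a cocone into a model $M$ and with a colimit $B$ in $\mathcal C$, and if $A\perp^M_C B_i$ for all $i\in I$, then $A\perp^M_C B$. - Local character: for every regular infinite cardinal $\lambda$ there is a regular infinite cardinal $\Upsilon(\lambda)$ such that for every model $M$ and all $A,B\le M$ with $A$ $\lambda$-presentable there is a $\Upsilon(\lambda)$-presentable $B'\le B$ with $A\perp^M_{B'}B$. - 3-amalgamation: let $M,N_1,N_2,N_3$ be models, with arrows $m_i\colon M\to N_i$ ($i=1,2,3$), $a_i\colon A\to N_i$ ($i=1,3$), $b_i\colon B\to N_i$ ($i=1,2$) and $c_i\colon C\to N_i$ ($i=2,3$). If, for the subobjects represented by these arrows, $A\perp^{N_1}_M B$, $B\perp^{N_2}_M C$ and $C\perp^{N_3}_M A$, and if $\mathrm{gtp}(a_1,m_1;N_1)=\mathrm{gtp}(a_3,m_3;N_3)$, $\mathrm{gtp}(b_1,m_1;N_1)=\mathrm{gtp}(b_2,m_2;N_2)$ and $\mathrm{gtp}(c_2,m_2;N_2)=\mathrm{gtp}(c_3,m_3;N_3)$,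 then there are extensions $f_i\colon N_i\to N$ ($i=1,2,3$) into one model $N$ with $f_1a_1=f_3a_3$, $f_1b_1=f_2b_2$, $f_2c_2=f_3c_3$, $f_1m_1=f_2m_2=f_3m_3$ and $A\perp^N_M N_2$. The claim is: if $(\mathcal C,\mathcal M)$ is an AECat with the amalgamation property and $\perp^{(1)}$ and $\perp^{(2)}$ are simple independence relations on it, then $\perp^{(1)}=\perp^{(2)}$, that is, for every model $M$ and all $A,B,C\le M$, $A\perp^{(1),M}_C B$ if and only if $A\perp^{(2),M}_C B$. -/

import Mathlib

open CategoryTheory CategoryTheory.Limits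

universe w u

/-- An AECat: an accessible category `C` with a full subcategory of models (given by a property of
objects) that is itself accessible and has directed colimits, which the inclusion into `C`
preserves, such that all arrows of `C` are monomorphisms. -/
class AECat (C : Type u) [Category.{w} C] where
  /-- The property of being a model. -/
  isModel : ObjectProperty C
  accessible : IsAccessibleCategory.{w} C
  accessible_models : IsAccessibleCategory.{w} isModel.FullSubcategory
  hasDirectedColimits (J : Type w) [PartialOrder J] [IsDirectedOrder J] [Nonempty J] :
    HasColimitsOfShape J isModel.FullSubcategory
  preservesDirectedColimits (J : Type w) [PartialOrder J] [IsDirectedOrder J] [Nonempty J] :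
    PreservesColimitsOfShape J isModel.ι
  mono {X Y : C} (f : X ⟶ Y) : Mono f

namespace AECat

attribute [instance] AECat.mono

/-- The models of an AECat, as objects of the full subcategory. For `M : Model C`, the underlying
object of `C` is `M.obj`. An extension of `M` is an arrow `M.obj ⟶ N.obj` with `N` a model. -/
abbrev Model (C : Type u) [Category.{w} C] [AECat C] : Type u :=
  (isModel (C := C)).FullSubcategory

variable {C : Type u} [Category.{w} C] [AECat C]

/-- The amalgamation property: every span of models can be completed to a commutative square of
models. -/
def AmalgamationProperty (C : Type u) [Category.{w} C] [AECat C] : Prop :=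
  ∀ (M N₁ N₂ : Model C) (f₁ : M.obj ⟶ N₁.obj) (f₂ : M.obj ⟶ N₂.obj),
    ∃ (U : Model C) (g₁ : N₁.obj ⟶ U.obj) (g₂ : N₂.obj ⟶ U.obj), f₁ ≫ g₁ = f₂ ≫ g₂

/-- The pairs of arrows `(a, b; M)` and `(a', b'; M')` have the same Galois type. -/
def SameGaloisType {A B : C} {M M' : Model C} (a : A ⟶ M.obj) (b : B ⟶ M.obj)
    (a' : A ⟶ M'.obj) (b' : B ⟶ M'.obj) : Prop :=
  ∃ (N : Model C) (f : M.obj ⟶ N.obj) (g : M'.obj ⟶ N.obj), a ≫ f = a' ≫ g ∧ b ≫ f = b' ≫ g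

/-- A subobject of `X`, viewed as a subobject of `Y` by composition with the (mono)morphism
`f : X ⟶ Y`. -/
noncomputable def push {X Y : C} (f : X ⟶ Y) (A : Subobject X) : Subobject Y :=
  (Subobject.map f).obj A

/-- The triples of subobjects `(A, B, D; M)` and `(A', B', D'; M')` have the same Galois type. -/
def SameGaloisTypeSub {M M' : Model C} (A B D : Subobject M.obj) (A' B' D' : Subobject M'.obj) :
    Prop :=
  ∃ (N : Model C) (f : M.obj ⟶ N.obj) (g : M'.obj ⟶ N.obj),
    push f A = push g A' ∧ push f B = push g B' ∧ push f D = push g D'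

/-- An independence relation: a relation on triples of subobjects of models. For such a relation
`R`, we read `R M A B D` as "`A` is independent from `B` over `D` in `M`"; the base comes last. -/
abbrev IndependenceRelation (C : Type u) [Category.{w} C] [AECat C] : Type (max u w) :=
  ∀ M : Model C, Subobject M.obj → Subobject M.obj → Subobject M.obj → Prop

namespace IndependenceRelation

variable (R : IndependenceRelation C)

def Invariance : Prop :=
  ∀ (M M' : Model C) (A B D : Subobject M.obj) (A' B' D' : Subobject M'.obj),
    R M A B D → SameGaloisTypeSub A B D A' B' D' → R M' A' B' D'

def Monotonicity : Prop :=
  ∀ (M : Model C) (A B B' D : Subobject M.obj), R M A B D → B' ≤ B → R M A B' D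

def BaseMonotonicity : Prop :=
  ∀ (M : Model C) (A B D D' : Subobject M.obj), R M A B D → D ≤ D' → D' ≤ B → R M A B D'

/-- The bases are nested: `B ≤ D`. -/
def Transitivity : Prop :=
  ∀ (M : Model C) (A B D F : Subobject M.obj), B ≤ D → R M A D B → R M A F D →
    ∃ (N : Model C) (f : M.obj ⟶ N.obj) (E : Subobject N.obj),
      R N (push f A) E (push f B) ∧ push f D ≤ E ∧ push f F ≤ E

def Symmetry : Prop :=
  ∀ (M : Model C) (A B D : Subobject M.obj), R M A B D → R M B A D

def Existence : Prop :=
  ∀ (M : Model C) (A D : C) (a : A ⟶ M.obj) (d : D ⟶ M.obj) (B : Subobject M.obj),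
    ∃ (M' : Model C) (f : M.obj ⟶ M'.obj) (a' : A ⟶ M'.obj),
      R M' (Subobject.mk a') (push f B) (Subobject.mk (d ≫ f)) ∧
        SameGaloisType a' (d ≫ f) a d

/-- `F` is a directed system in `C` with colimit `c.pt`; its cocones with vertex `M` correspond to
the arrows `b` from the colimit to `M`. -/
def Union : Prop :=
  ∀ (M : Model C) (A D : Subobject M.obj) (I : Type w) [PartialOrder I] [IsDirectedOrder I]
    [Nonempty I] (F : I ⥤ C) (c : Cocone F) (_ : IsColimit c) (b : c.pt ⟶ M.obj),
    (∀ i : I, R M A (Subobject.mk (c.ι.app i ≫ b)) D) → R M A (Subobject.mk b) D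

def LocalCharacter : Prop :=
  ∀ (κ : Cardinal.{w}) [Fact κ.IsRegular], ∃ (υ : Cardinal.{w}) (_ : Fact υ.IsRegular),
    ∀ (M : Model C) (A B : Subobject M.obj), IsCardinalPresentable (A : C) κ →
      ∃ B' : Subobject M.obj, B' ≤ B ∧ IsCardinalPresentable (B' : C) υ ∧ R M A B B'

def ThreeAmalgamation : Prop :=
  ∀ (A B D : C) (M N₁ N₂ N₃ : Model C)
    (a₁ : A ⟶ N₁.obj) (b₁ : B ⟶ N₁.obj) (m₁ : M.obj ⟶ N₁.obj)
    (b₂ : B ⟶ N₂.obj) (d₂ : D ⟶ N₂.obj) (m₂ : M.obj ⟶ N₂.obj)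
    (d₃ : D ⟶ N₃.obj) (a₃ : A ⟶ N₃.obj) (m₃ : M.obj ⟶ N₃.obj),
    R N₁ (Subobject.mk a₁) (Subobject.mk b₁) (Subobject.mk m₁) →
    R N₂ (Subobject.mk b₂) (Subobject.mk d₂) (Subobject.mk m₂) →
    R N₃ (Subobject.mk d₃) (Subobject.mk a₃) (Subobject.mk m₃) →
    SameGaloisType a₁ m₁ a₃ m₃ →
    SameGaloisType b₁ m₁ b₂ m₂ →
    SameGaloisType d₂ m₂ d₃ m₃ →
    ∃ (N : Model C) (f₁ : N₁.obj ⟶ N.obj) (f₂ : N₂.obj ⟶ N.obj) (f₃ : N₃.obj ⟶ N.obj),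
      a₁ ≫ f₁ = a₃ ≫ f₃ ∧ b₁ ≫ f₁ = b₂ ≫ f₂ ∧ d₂ ≫ f₂ = d₃ ≫ f₃ ∧
      m₁ ≫ f₁ = m₂ ≫ f₂ ∧ m₂ ≫ f₂ = m₃ ≫ f₃ ∧
      R N (Subobject.mk (a₁ ≫ f₁)) (Subobject.mk f₂) (Subobject.mk (m₁ ≫ f₁))

/-- A simple independence relation. -/
structure IsSimple : Prop where
  invariance : Invariance R
  monotonicity : Monotonicity R
  baseMonotonicity : BaseMonotonicity R
  transitivity : Transitivity R
  symmetry : Symmetry R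
  existence : Existence R
  union : Union R
  localCharacter : LocalCharacter R
  threeAmalgamation : ThreeAmalgamation R

end IndependenceRelation

end AECat

/-!
Let `R₂` satisfy union and 3-amalgamation, let `R₁` satisfy local character, and let `A` be
`R₂`-independent from `B` over a model `M₀`, where `A` and `B` are models. Build a long chain of
`R₂`-independent squares over `M₀ ⟶ A` along which copies of `B` form an `R₁`-independent sequence
over `M₀`. At successor steps 3-amalgamation makes the new copy of `B` have the given Galois type
together with `A`; at limit steps independence of the squares persists by union. By local character
`A` is `R₁`-independent from one of the copies, hence from `B`.

In order to apply 3-amalgamation, the next copy of `B` has to be independent from the model built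
so far for both relations. Such amalgams come from the same use of local character: a model which is
`R₂`-independent from the colimit of a long `R₁`-independent sequence is `R₁`-independent from one
of its terms. Arbitrary tuples and bases are then replaced by models using existence.
-/

namespace AECat

section Chains

variable (J : Type w) [LinearOrder J] [Nonempty J] {E : Type*} [Category E]

lemma hasIterationOfShape_of_hasColimitsOfShape
    (hE : ∀ (J : Type w) [LinearOrder J] [Nonempty J], HasColimitsOfShape J E) :
    HasIterationOfShape J E where
  hasColimitsOfShape_of_isSuccLimit j hj := by
    have := hj.nonempty_Iio.to_subtype
    exact hE (Set.Iio j)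
  hasColimitsOfShape := hE J

lemma exists_functor_forall_exists_map [WellFoundedLT J] [NoMaxOrder J]
    [HasIterationOfShape J E] [Nonempty E] (W : MorphismProperty E)
    (hW : ∀ X, ∃ (Y : E) (f : X ⟶ Y), W f) :
    ∃ F : J ⥤ E, ∀ i, ∃ (j : J) (f : i ⟶ j), W (F.map f) := by
  let _ : SuccOrder J := SuccOrder.ofLinearWellFoundedLT J
  let _ : OrderBot J := WellFoundedLT.toOrderBot J
  choose Y f hf using hW
  let Φ : SmallObject.SuccStruct E := ⟨Classical.arbitrary E, Y, f⟩
  have hΦ : Φ.prop ≤ W := by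
    rintro _ _ _ ⟨_⟩
    exact hf _
  exact ⟨Φ.iterationFunctor J, fun i ↦ ⟨Order.succ i, homOfLE (Order.le_succ i),
    hΦ _ (Φ.prop_iterationFunctor_map_succ i (not_isMax i))⟩⟩

lemma exists_isColimit_forall_exists_map [WellFoundedLT J] [NoMaxOrder J]
    (hE : ∀ (J : Type w) [LinearOrder J] [Nonempty J], HasColimitsOfShape J E)
    {P : ObjectProperty E}
    (hP : ∀ (J : Type w) [LinearOrder J] [Nonempty J], P.IsClosedUnderColimitsOfShape J)
    {X₀ : E} (hX₀ : P X₀) {W : MorphismProperty E}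
    (hW : ∀ X, P X → ∃ (Y : E) (f : X ⟶ Y), P Y ∧ W f) :
    ∃ (F : J ⥤ E) (c : Cocone F) (_ : IsColimit c), ∀ i, ∃ (j : J) (f : i ⟶ j), W (F.map f) := by
  have := hE J
  have := hasIterationOfShape_of_hasColimitsOfShape J (E := P.FullSubcategory) fun J _ _ ↦
    have := hE J
    have := hP J
    inferInstance
  have : Nonempty P.FullSubcategory := ⟨⟨X₀, hX₀⟩⟩
  obtain ⟨F, hF⟩ := exists_functor_forall_exists_map J (W.inverseImage P.ι) fun X ↦ by
    obtain ⟨Y, f, hY, hf⟩ := hW X.obj X.property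
    exact ⟨⟨Y, hY⟩, ObjectProperty.homMk f, hf⟩
  exact ⟨F ⋙ P.ι, _, colimit.isColimit _, hF⟩

end Chains

variable {C : Type u} [Category.{w} C] [AECat C]

attribute [instance] hasDirectedColimits preservesDirectedColimits

attribute [local instance] IsFiltered.isConnected

lemma push_mk {X Y A : C} (f : X ⟶ Y) (a : A ⟶ X) :
    push f (Subobject.mk a) = Subobject.mk (a ≫ f) :=
  Subobject.map_mk a f

lemma AmalgamationProperty.sameGaloisType (hAP : AmalgamationProperty C) {M A N N' : Model C}
    (m : M ⟶ A) (a : A ⟶ N) (a' : A ⟶ N') :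
    SameGaloisType a.hom (m ≫ a).hom a'.hom (m ≫ a').hom := by
  obtain ⟨U, f, g, hfg⟩ := hAP A N N' a.hom a'.hom
  exact ⟨U, f, g, hfg, by simp [hfg]⟩

namespace IndependenceRelation

/-- Independence of subobjects of a model represented by arrows into it; the base comes last. -/
def Ind (R : IndependenceRelation C) {M : Model C} {A B D : C}
    (a : A ⟶ M.obj) (b : B ⟶ M.obj) (d : D ⟶ M.obj) : Prop :=
  R M (Subobject.mk a) (Subobject.mk b) (Subobject.mk d)

/-- The properties of a simple independence relation other than union, local character and
3-amalgamation. -/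
structure IsBasic (R : IndependenceRelation C) : Prop where
  invariance : R.Invariance
  monotonicity : R.Monotonicity
  baseMonotonicity : R.BaseMonotonicity
  transitivity : R.Transitivity
  symmetry : R.Symmetry
  existence : R.Existence

lemma IsSimple.isBasic {R : IndependenceRelation C} (hR : R.IsSimple) : R.IsBasic where
  __ := hR

variable {R R₁ R₂ : IndependenceRelation C} {M N : Model C} {A B D E : C}
  {a : A ⟶ M.obj} {b : B ⟶ M.obj} {d : D ⟶ M.obj}

lemma Invariance.ind_comp (hR : R.Invariance) (h : R.Ind a b d) (f : M.obj ⟶ N.obj) :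
    R.Ind (a ≫ f) (b ≫ f) (d ≫ f) :=
  hR _ _ _ _ _ _ _ _ h ⟨N, f, 𝟙 _, by simp [push_mk], by simp [push_mk], by simp [push_mk]⟩

lemma Invariance.ind_of_comp (hR : R.Invariance) (f : M.obj ⟶ N.obj)
    (h : R.Ind (a ≫ f) (b ≫ f) (d ≫ f)) : R.Ind a b d :=
  hR _ _ _ _ _ _ _ _ h ⟨N, 𝟙 _, f, by simp [push_mk], by simp [push_mk], by simp [push_mk]⟩

lemma Monotonicity.ind_comp (hR : R.Monotonicity) (h : R.Ind a b d) (x : E ⟶ B) :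
    R.Ind a (x ≫ b) d :=
  hR _ _ _ _ _ h (Subobject.mk_le_mk_of_comm x rfl)

lemma Symmetry.ind (hR : R.Symmetry) (h : R.Ind a b d) : R.Ind b a d :=
  hR _ _ _ _ h

lemma BaseMonotonicity.ind (hR : R.BaseMonotonicity) (x : D ⟶ E) (y : E ⟶ B)
    (h : R.Ind a b (x ≫ y ≫ b)) : R.Ind a b (y ≫ b) :=
  hR _ _ _ _ _ h (Subobject.mk_le_mk_of_comm x rfl) (Subobject.mk_le_mk_of_comm y rfl)

lemma Existence.exists_ind (hR : R.Existence) (hinv : R.Invariance) (a : A ⟶ M.obj)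
    (d : D ⟶ M.obj) :
    ∃ (N : Model C) (f g : M.obj ⟶ N.obj), d ≫ f = d ≫ g ∧ R.Ind (a ≫ g) f (d ≫ f) := by
  obtain ⟨M', f, a', h, N, p, q, ha, hd⟩ := hR M A D a d (Subobject.mk (𝟙 _))
  simp only [push_mk, Category.id_comp] at h
  refine ⟨N, f ≫ p, q, by simpa using hd, ?_⟩
  simpa [ha] using hinv.ind_comp h p

lemma Union.ind_of_isColimit (hR : R.Union) {J : Type w} [PartialOrder J] [IsDirectedOrder J]
    [Nonempty J] {G : J ⥤ Model C} {c : Cocone G} (hc : IsColimit c)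
    {t : c.pt.obj ⟶ M.obj} (h : ∀ j, R.Ind a ((c.ι.app j).hom ≫ t) d) : R.Ind a t d :=
  hR M _ _ J (G ⋙ isModel.ι) (isModel.ι.mapCocone c) (isColimitOfPreserves isModel.ι hc) t h

namespace IsBasic

variable (hR : R.IsBasic)
include hR

lemma ind_base (a : A ⟶ M.obj) (d : D ⟶ M.obj) : R.Ind a d d := by
  obtain ⟨N, f, g, hd, h⟩ := hR.existence.exists_ind hR.invariance a d
  have := hR.monotonicity.ind_comp h d
  rw [hd] at this
  exact hR.invariance.ind_of_comp g this

lemma exists_ind_trans {e : E ⟶ M.obj} (x : D ⟶ B) (h₁ : R.Ind a b (x ≫ b)) (h₂ : R.Ind a e b) :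
    ∃ (N : Model C) (f : M.obj ⟶ N.obj) (F : C) (t : F ⟶ N.obj) (y : B ⟶ F) (z : E ⟶ F),
      R.Ind (a ≫ f) t (x ≫ b ≫ f) ∧ y ≫ t = b ≫ f ∧ z ≫ t = e ≫ f := by
  obtain ⟨N, f, S, h, hb, he⟩ := hR.transitivity _ _ _ _ _
    (Subobject.mk_le_mk_of_comm x rfl) h₁ h₂
  simp only [push_mk] at h hb he
  rw [← Subobject.mk_arrow S] at h hb he
  exact ⟨N, f, _, S.arrow, Subobject.ofMkLEMk _ _ hb, Subobject.ofMkLEMk _ _ he,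
    by simpa [Ind] using h, Subobject.ofMkLEMk_comp hb, Subobject.ofMkLEMk_comp he⟩

lemma ind_trans {e : E ⟶ M.obj} (x : D ⟶ B) (h₁ : R.Ind a b (x ≫ b)) (h₂ : R.Ind a e b) :
    R.Ind a e (x ≫ b) := by
  obtain ⟨N, f, F, t, _, z, h, _, hz⟩ := hR.exists_ind_trans x h₁ h₂
  have h' := hR.monotonicity.ind_comp h z
  rw [hz, ← Category.assoc] at h'
  exact hR.invariance.ind_of_comp f h'

lemma ind_trans_right {e : E ⟶ M.obj} (x : D ⟶ E) (h₁ : R.Ind b e (x ≫ e)) (h₂ : R.Ind a b e) :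
    R.Ind a b (x ≫ e) :=
  hR.symmetry.ind (hR.ind_trans x h₁ (hR.symmetry.ind h₂))

lemma exists_ind_extension (h : R.Ind a b d) :
    ∃ (N : Model C) (f g : M.obj ⟶ N.obj), b ≫ f = b ≫ g ∧ d ≫ f = d ≫ g ∧
      R.Ind (a ≫ g) f (d ≫ f) := by
  obtain ⟨N, f, F, t, y, z, h', hy, hz⟩ :=
    hR.exists_ind_trans (𝟙 D) (by simpa using hR.ind_base a d) h
  rw [Category.id_comp, ← hy] at h'
  obtain ⟨N', p, q, ht, hp⟩ := hR.existence.exists_ind hR.invariance (a ≫ f) t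
  have hq : R.Ind ((a ≫ f) ≫ q) (t ≫ p) (y ≫ t ≫ p) := by
    simpa [ht] using hR.invariance.ind_comp h' q
  have hp' := hR.monotonicity.ind_comp (hR.ind_trans y hq hp) f
  refine ⟨N', f ≫ p, f ≫ q, ?_, ?_, ?_⟩
  · rw [← reassoc_of% hz, ht, reassoc_of% hz]
  · rw [← reassoc_of% hy, ht, reassoc_of% hy]
  · simpa [reassoc_of% hy] using hp'

lemma exists_ind_amalgam (hAP : AmalgamationProperty C) {M₀ A B : Model C} (m : M₀ ⟶ A)
    (n : M₀ ⟶ B) :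
    ∃ (N : Model C) (a : A ⟶ N) (b : B ⟶ N), m ≫ a = n ≫ b ∧
      R.Ind a.hom b.hom (n ≫ b).hom := by
  obtain ⟨V, p, q, hpq⟩ := hAP M₀ A B m.hom n.hom
  obtain ⟨N, f, g, hfg, h⟩ := hR.existence.exists_ind hR.invariance p (n.hom ≫ q)
  refine ⟨N, ObjectProperty.homMk (p ≫ g), ObjectProperty.homMk (q ≫ f),
    ObjectProperty.hom_ext _ ?_, ?_⟩
  · simpa [reassoc_of% hpq] using hfg.symm
  · simpa using hR.monotonicity.ind_comp h q

end IsBasic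

lemma LocalCharacter.exists_isCardinalFiltered_ind (hR : R.LocalCharacter)
    (hbase : R.BaseMonotonicity) (A : C) :
    ∃ (κ : Cardinal.{w}) (_ : Fact κ.IsRegular), ∀ (J : Type w) [LinearOrder J]
      [IsCardinalFiltered J κ] (G : J ⥤ C) (c : Cocone G) (_ : IsColimit c) (M : Model C)
      (a : A ⟶ M.obj) (t : c.pt ⟶ M.obj), ∃ i, R.Ind a t (c.ι.app i ≫ t) := by
  have := AECat.accessible (C := C)
  obtain ⟨κ₀, _, hA⟩ := (inferInstance : IsPresentable.{w} A).exists_cardinal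
  have : IsCardinalPresentable A κ₀ := ⟨hA.1⟩
  obtain ⟨κ, hκ, h⟩ := hR κ₀
  refine ⟨κ, hκ, fun J _ _ G c hc M a t ↦ ?_⟩
  obtain ⟨S, hSt, _, hS⟩ := h M (Subobject.mk a) (Subobject.mk t)
    (isCardinalPresentable_of_iso (Subobject.underlyingIso a).symm κ₀)
  obtain ⟨i, y, hy⟩ := IsCardinalPresentable.exists_hom_of_isColimit κ hc
    (Subobject.ofLEMk S t hSt)
  have hSi : S ≤ Subobject.mk (c.ι.app i ≫ t) :=
    Subobject.le_mk_of_comm y (by rw [← Category.assoc, hy, Subobject.ofLEMk_comp])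
  exact ⟨i, hbase _ _ _ _ _ hS hSi (Subobject.mk_le_mk_of_comm (c.ι.app i) rfl)⟩

/-- Applied to a long sequence of `b`s, each independent from the part of the chain preceding it,
this yields a term of the sequence from which `a` is independent. -/
lemma IsBasic.exists_forall_isColimit_exists_ind (hR : R.IsBasic)
    (hlocal : R.LocalCharacter) (A : C) :
    ∃ (J : Type w) (_ : LinearOrder J) (_ : Nonempty J) (_ : WellFoundedLT J) (_ : NoMaxOrder J),
      ∀ (G : J ⥤ Model C) (c : Cocone G) (_ : IsColimit c) (M : Model C) (a : A ⟶ M.obj)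
        (t : c.pt.obj ⟶ M.obj), ∃ i, ∀ (j : J) (f : i ⟶ j) {B D : C} (b : B ⟶ (G.obj j).obj)
        (d : D ⟶ (G.obj i).obj), R.Ind b (G.map f).hom (d ≫ (G.map f).hom) →
          R.Ind a (b ≫ (c.ι.app j).hom ≫ t) (d ≫ (c.ι.app i).hom ≫ t) := by
  obtain ⟨κ, hκ, h⟩ := hlocal.exists_isCardinalFiltered_ind hR.baseMonotonicity A
  have : Nonempty κ.ord.ToType := by simpa using hκ.out.ne_zero
  refine ⟨κ.ord.ToType, inferInstance, this, inferInstance,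
    Cardinal.noMaxOrder hκ.out.aleph0_le, fun G c hc M a t ↦ ?_⟩
  obtain ⟨i, hi⟩ := h κ.ord.ToType (G ⋙ isModel.ι) (isModel.ι.mapCocone c)
    (isColimitOfPreserves isModel.ι hc) M a t
  refine ⟨i, fun j f B D b d hb ↦ hR.ind_trans_right d ?_ ?_⟩
  · have hij : (G.map f).hom ≫ (c.ι.app j).hom = (c.ι.app i).hom := by
      rw [← ObjectProperty.FullSubcategory.comp_hom, c.w f]
    simpa [reassoc_of% hij] using hR.invariance.ind_comp hb ((c.ι.app j).hom ≫ t)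
  · simpa using hR.monotonicity.ind_comp hi (b ≫ (c.ι.app j).hom)

section Comparison

variable {M₀ A B : Model C}

lemma exists_ind_ind_amalgam (hAP : AmalgamationProperty C) (h₁ : R₁.IsBasic)
    (hlocal : R₁.LocalCharacter) (h₂ : R₂.IsBasic) (m : M₀ ⟶ A) (n : M₀ ⟶ B) :
    ∃ (N : Model C) (a : A ⟶ N) (b : B ⟶ N), m ≫ a = n ≫ b ∧
      R₁.Ind a.hom b.hom (n ≫ b).hom ∧ R₂.Ind a.hom b.hom (n ≫ b).hom := by
  obtain ⟨J, _, _, _, _, hJ⟩ := h₁.exists_forall_isColimit_exists_ind hlocal A.obj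
  let W : MorphismProperty (Under M₀) := fun _ Y f ↦
    ∃ b : B ⟶ Y.right, n ≫ b = Y.hom ∧ R₁.Ind b.hom f.right.hom Y.hom.hom
  have hW (X : Under M₀) (_ : (⊤ : ObjectProperty (Under M₀)) X) :
      ∃ (Y : Under M₀) (f : X ⟶ Y), (⊤ : ObjectProperty (Under M₀)) Y ∧ W f := by
    obtain ⟨N, b, x, hbx, h⟩ := h₁.exists_ind_amalgam hAP n X.hom
    exact ⟨Under.mk (X.hom ≫ x), Under.homMk x, trivial, b, hbx, h⟩
  obtain ⟨F, c, hc, hF⟩ := exists_isColimit_forall_exists_map J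
    (fun J _ _ ↦ inferInstance) (fun J _ _ ↦ ⟨fun _ _ ↦ trivial⟩)
    (X₀ := Under.mk (𝟙 M₀)) trivial hW
  obtain ⟨N, a, t, hat, h⟩ := h₂.exists_ind_amalgam hAP m c.pt.hom
  obtain ⟨i, hi⟩ := hJ (F ⋙ Under.forget M₀) _
    (isColimitOfPreserves (Under.forget M₀) hc) N a.hom t.hom
  obtain ⟨j, f, b, hb, hbf⟩ := hF i
  have hFf : (F.obj i).hom ≫ (F.map f).right = (F.obj j).hom := Under.w (F.map f)
  have hFc (i : J) : (F.obj i).hom ≫ (c.ι.app i).right = c.pt.hom := Under.w (c.ι.app i)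
  have hn : n ≫ b ≫ (c.ι.app j).right ≫ t = c.pt.hom ≫ t := by
    rw [reassoc_of% hb, reassoc_of% hFc]
  refine ⟨N, a, b ≫ (c.ι.app j).right ≫ t, by rw [hat, hn], ?_, ?_⟩
  · rw [hn, ← hFc i, Category.assoc]
    exact hi j f b.hom (F.obj i).hom.hom (by rwa [← hFf] at hbf)
  · rw [hn]
    simpa using h₂.monotonicity.ind_comp h (b ≫ (c.ι.app j).right).hom

/-- The property of being an independent square over `m : M₀ ⟶ A`. A commutative square with `m`
on one side is an arrow out of `m` in the arrow category: it consists of an arrow `k : N ⟶ K` of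
models, an arrow `M₀ ⟶ N` and an arrow `a : A ⟶ K`, and is independent if `a` is independent from
`k` over `M₀`. -/
def indepSquare (R : IndependenceRelation C) (m : M₀ ⟶ A) : ObjectProperty (Under (Arrow.mk m)) :=
  fun X ↦ R.Ind X.hom.right.hom X.right.hom.hom (m ≫ X.hom.right).hom

lemma indepSquare_isClosedUnderColimitsOfShape (hR : R.Invariance) (hunion : R.Union) (m : M₀ ⟶ A)
    (J : Type w) [LinearOrder J] [Nonempty J] :
    (R.indepSquare m).IsClosedUnderColimitsOfShape J := by
  refine ⟨fun X ⟨h⟩ ↦ ?_⟩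
  refine hunion.ind_of_isColimit
    (isColimitOfPreserves (Under.forget _ ⋙ Arrow.leftFunc) h.isColimit) fun j ↦ ?_
  have hright : (h.diag.obj j).hom.right ≫ (h.ι.app j).right.right = X.hom.right :=
    congrArg Arrow.Hom.right (Under.w (h.ι.app j))
  have hsquare : (h.ι.app j).right.left ≫ X.right.hom =
      (h.diag.obj j).right.hom ≫ (h.ι.app j).right.right := (h.ι.app j).right.w
  change R.Ind X.hom.right.hom ((h.ι.app j).right.left ≫ X.right.hom).hom (m ≫ X.hom.right).hom
  rw [hsquare, ← hright]
  simpa using hR.ind_comp (h.prop_diag_obj j) (h.ι.app j).right.right.hom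

lemma ThreeAmalgamation.exists_hom (hthree : R.ThreeAmalgamation) (hAP : AmalgamationProperty C)
    {M A B D N₁ N₂ N₃ : Model C} {mA : M ⟶ A} {mB : M ⟶ B} {mD : M ⟶ D}
    {a₁ : A ⟶ N₁} {b₁ : B ⟶ N₁} {b₂ : B ⟶ N₂} {d₂ : D ⟶ N₂} {d₃ : D ⟶ N₃} {a₃ : A ⟶ N₃}
    (hab : mA ≫ a₁ = mB ≫ b₁) (hbd : mB ≫ b₂ = mD ≫ d₂) (hda : mD ≫ d₃ = mA ≫ a₃)
    (h₁ : R.Ind a₁.hom b₁.hom (mA ≫ a₁).hom) (h₂ : R.Ind b₂.hom d₂.hom (mB ≫ b₂).hom)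
    (h₃ : R.Ind d₃.hom a₃.hom (mD ≫ d₃).hom) :
    ∃ (N : Model C) (f₁ : N₁ ⟶ N) (f₂ : N₂ ⟶ N) (f₃ : N₃ ⟶ N),
      a₁ ≫ f₁ = a₃ ≫ f₃ ∧ b₁ ≫ f₁ = b₂ ≫ f₂ ∧ d₂ ≫ f₂ = d₃ ≫ f₃ ∧
      R.Ind (a₁ ≫ f₁).hom f₂.hom (mA ≫ a₁ ≫ f₁).hom := by
  obtain ⟨N, f₁, f₂, f₃, ha, hb, hd, -, -, h⟩ := hthree _ _ _ _ _ _ _ _ _ _ _ _ _ _ _ _ h₁ h₂ h₃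
    (hda ▸ hAP.sameGaloisType mA a₁ a₃) (hab ▸ hAP.sameGaloisType mB b₁ b₂)
    (hbd ▸ hAP.sameGaloisType mD d₂ d₃)
  exact ⟨N, ObjectProperty.homMk f₁, ObjectProperty.homMk f₂, ObjectProperty.homMk f₃,
    ObjectProperty.hom_ext _ ha, ObjectProperty.hom_ext _ hb, ObjectProperty.hom_ext _ hd,
    by simpa [Ind] using h⟩

variable {m : M₀ ⟶ A} {n : M₀ ⟶ B}

lemma exists_indepSquare_hom (hAP : AmalgamationProperty C) (h₁ : R₁.IsBasic)
    (hlocal : R₁.LocalCharacter) (h₂ : R₂.IsBasic) (hthree : R₂.ThreeAmalgamation) {M : Model C}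
    {a : A ⟶ M} {b : B ⟶ M} (hab : m ≫ a = n ≫ b) (h : R₂.Ind a.hom b.hom (m ≫ a).hom)
    {X : Under (Arrow.mk m)} (hX : R₂.indepSquare m X) :
    ∃ (Y : Under (Arrow.mk m)) (f : X ⟶ Y) (b' : B ⟶ Y.right.left) (g : M ⟶ Y.right.right),
      R₂.indepSquare m Y ∧ R₁.Ind b'.hom f.right.left.hom Y.hom.left.hom ∧
        a ≫ g = Y.hom.right ∧ b ≫ g = b' ≫ Y.right.hom := by
  obtain ⟨N, b', x, hbx, hx₁, hx₂⟩ := exists_ind_ind_amalgam hAP h₁ hlocal h₂ n X.hom.left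
  have hXw : X.hom.left ≫ X.right.hom = m ≫ X.hom.right := X.hom.w
  obtain ⟨K, g, k, q, hag, hbg, hxk, hk⟩ := hthree.exists_hom hAP hab hbx hXw h (hbx ▸ hx₂)
    (h₂.symmetry.ind (hXw ▸ hX))
  have hsquare : (X.hom.left ≫ x) ≫ k = m ≫ a ≫ g := by
    rw [Category.assoc, hxk, reassoc_of% hXw, hag]
  let Y : Under (Arrow.mk m) :=
    Under.mk (Y := Arrow.mk k) (Arrow.homMk (X.hom.left ≫ x) (a ≫ g) hsquare)
  let f : X ⟶ Y := Under.homMk (Arrow.homMk x q hxk) (Arrow.hom_ext _ _ rfl hag.symm)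
  exact ⟨Y, f, b', g, hk, hx₁, rfl, hbg⟩

lemma ind_of_ind_models (hAP : AmalgamationProperty C) (h₁ : R₁.IsBasic)
    (hlocal : R₁.LocalCharacter) (h₂ : R₂.IsBasic) (hunion : R₂.Union)
    (hthree : R₂.ThreeAmalgamation) {M : Model C} {a : A ⟶ M} {b : B ⟶ M} (hab : m ≫ a = n ≫ b)
    (h : R₂.Ind a.hom b.hom (m ≫ a).hom) : R₁.Ind a.hom b.hom (m ≫ a).hom := by
  obtain ⟨J, _, _, _, _, hJ⟩ := h₁.exists_forall_isColimit_exists_ind hlocal A.obj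
  let W : MorphismProperty (Under (Arrow.mk m)) := fun _ Y f ↦
    ∃ (b' : B ⟶ Y.right.left) (g : M ⟶ Y.right.right),
      R₁.Ind b'.hom f.right.left.hom Y.hom.left.hom ∧ a ≫ g = Y.hom.right ∧
      b ≫ g = b' ≫ Y.right.hom
  have hW (X : Under (Arrow.mk m)) (hX : R₂.indepSquare m X) :
      ∃ (Y : Under (Arrow.mk m)) (f : X ⟶ Y), R₂.indepSquare m Y ∧ W f := by
    obtain ⟨Y, f, b', g, hY, h⟩ := exists_indepSquare_hom hAP h₁ hlocal h₂ hthree hab h hX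
    exact ⟨Y, f, hY, b', g, h⟩
  obtain ⟨F, c, hc, hF⟩ := exists_isColimit_forall_exists_map J (fun J _ _ ↦ inferInstance)
    (fun J _ _ ↦ indepSquare_isClosedUnderColimitsOfShape h₂.invariance hunion m J)
    (X₀ := Under.mk (𝟙 (Arrow.mk m)))
    (by simpa [indepSquare] using h₂.ind_base (𝟙 A.obj) m.hom) hW
  obtain ⟨i, hi⟩ := hJ (F ⋙ Under.forget _ ⋙ Arrow.leftFunc) _
    (isColimitOfPreserves (Under.forget _ ⋙ Arrow.leftFunc) hc) c.pt.right.right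
    c.pt.hom.right.hom c.pt.right.hom.hom
  obtain ⟨j, f, b', g, hind, hag, hbg⟩ := hF i
  have hleft : (F.obj i).hom.left ≫ (F.map f).right.left = (F.obj j).hom.left :=
    congrArg Arrow.Hom.left (Under.w (F.map f))
  have hbase : (F.obj i).hom.left ≫ (c.ι.app i).right.left = c.pt.hom.left :=
    congrArg Arrow.Hom.left (Under.w (c.ι.app i))
  have hright : (F.obj j).hom.right ≫ (c.ι.app j).right.right = c.pt.hom.right :=
    congrArg Arrow.Hom.right (Under.w (c.ι.app j))
  have hsquare : (c.ι.app j).right.left ≫ c.pt.right.hom =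
      (F.obj j).right.hom ≫ (c.ι.app j).right.right := (c.ι.app j).right.w
  have hpt : c.pt.hom.left ≫ c.pt.right.hom = m ≫ c.pt.hom.right := c.pt.hom.w
  let g' : M ⟶ c.pt.right.right := g ≫ (c.ι.app j).right.right
  have ha' : a ≫ g' = c.pt.hom.right := by simp only [g', reassoc_of% hag, hright]
  have hb' : b ≫ g' = b' ≫ (c.ι.app j).right.left ≫ c.pt.right.hom := by
    simp only [g', reassoc_of% hbg, hsquare]
  apply h₁.invariance.ind_of_comp g'.hom
  change R₁.Ind (a ≫ g').hom (b ≫ g').hom ((m ≫ a) ≫ g').hom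
  rw [Category.assoc, ha', hb', ← hpt, ← hbase, Category.assoc]
  exact hi j f b'.hom (F.obj i).hom.left.hom (by rwa [← hleft] at hind)

end Comparison

lemma ind_of_ind_model (hAP : AmalgamationProperty C) (h₁ : R₁.IsBasic)
    (hlocal : R₁.LocalCharacter) (h₂ : R₂.IsBasic) (hunion : R₂.Union)
    (hthree : R₂.ThreeAmalgamation) {M₀ B M : Model C} {a : A ⟶ M.obj} {n : M₀ ⟶ B} {b : B ⟶ M}
    (h : R₂.Ind b.hom a (n ≫ b).hom) : R₁.Ind b.hom a (n ≫ b).hom := by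
  obtain ⟨N, f, g, hf, hn, h'⟩ := h₂.exists_ind_extension h
  have hn' : n ≫ b ≫ ObjectProperty.homMk g = (n ≫ b) ≫ ObjectProperty.homMk f := by
    rw [← Category.assoc]
    exact ObjectProperty.hom_ext _ hn.symm
  have hind : R₁.Ind (b.hom ≫ g) f (n.hom ≫ b.hom ≫ g) :=
    ind_of_ind_models (m := n) (n := n ≫ b) hAP h₁ hlocal h₂ hunion hthree hn' (hn' ▸ h')
  have := h₁.monotonicity.ind_comp hind a
  rw [hf] at this
  refine h₁.invariance.ind_of_comp g ?_
  simpa using this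

lemma ind_of_ind (hAP : AmalgamationProperty C) (h₁ : R₁.IsBasic)
    (hlocal : R₁.LocalCharacter) (h₂ : R₂.IsBasic) (hunion : R₂.Union)
    (hthree : R₂.ThreeAmalgamation) (h : R₂.Ind a b d) : R₁.Ind a b d := by
  obtain ⟨M₁, f, g, hd, hg⟩ := h₁.existence.exists_ind h₁.invariance (𝟙 M.obj) d
  obtain ⟨N, p, q, hb, hdpq, hp⟩ := h₂.exists_ind_extension (h₂.invariance.ind_comp h f)
  have hbase₂ : R₂.Ind ((a ≫ f) ≫ q) p (g ≫ p) :=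
    h₂.baseMonotonicity.ind d g (by simpa [reassoc_of% hd] using hp)
  have hbase₁ : R₁.Ind p ((a ≫ f) ≫ q) (g ≫ p) :=
    ind_of_ind_model (n := ObjectProperty.homMk g) (b := ObjectProperty.homMk p)
      hAP h₁ hlocal h₂ hunion hthree (h₂.symmetry.ind hbase₂)
  have hbf : R₁.Ind ((b ≫ f) ≫ p) (g ≫ p) (d ≫ g ≫ p) := by
    have := h₁.symmetry.ind (h₁.monotonicity.ind_comp hg b)
    simpa [hd] using h₁.invariance.ind_comp this p
  have hab : R₁.Ind ((a ≫ f) ≫ q) ((b ≫ f) ≫ p) (d ≫ g ≫ p) :=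
    h₁.ind_trans_right d hbf
      (by simpa using h₁.monotonicity.ind_comp (h₁.symmetry.ind hbase₁) (b ≫ f))
  rw [hb, ← reassoc_of% hd, ← Category.assoc d, hdpq] at hab
  exact h₁.invariance.ind_of_comp f (h₁.invariance.ind_of_comp q hab)

end IndependenceRelation

end AECat

open AECat IndependenceRelation in
theorem mainTheorem2_general {C : Type u} [Category.{w} C] [AECat C]
    (hAP : AmalgamationProperty C) {R₁ R₂ : IndependenceRelation C}
    (h₁ : R₁.IsBasic) (hlocal : R₁.LocalCharacter)
    (h₂ : R₂.IsBasic) (hunion : R₂.Union) (hthree : R₂.ThreeAmalgamation) : R₂ ≤ R₁ := by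
  intro M A B D h
  rw [← Subobject.mk_arrow A, ← Subobject.mk_arrow B, ← Subobject.mk_arrow D] at h ⊢
  exact ind_of_ind hAP h₁ hlocal h₂ hunion hthree h

theorem mainTheorem2 {C : Type u} [Category.{w} C] [AECat.{w, u} C]
    (hAP : AECat.AmalgamationProperty C) (R₁ R₂ : AECat.IndependenceRelation C)
    (h₁ : AECat.IndependenceRelation.IsSimple R₁) (h₂ : AECat.IndependenceRelation.IsSimple R₂) :
    R₁ = R₂ :=
  le_antisymm
    (mainTheorem2_general hAP h₂.isBasic h₂.localCharacter h₁.isBasic h₁.union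
      h₁.threeAmalgamation)
    (mainTheorem2_general hAP h₁.isBasic h₁.localCharacter h₂.isBasic h₂.union
      h₂.threeAmalgamation)
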